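/- Let $n,k,r$ be positive integers with $r\ge 2$ and $n\ge rk$. Place the points $1,\dots,n$ in this order around a circle. Let $\mathrm{IG}_{n,k}^{(r)}$ be the graph whose vertices are the $k$-subsets $S$ of $\{1,\dots,n\}$ that are $r$-stable (on each of the two arcs between any two distinct points of $S$ there are at least $r-1$ points of $\{1,\dots,n\}$), where $P=\{p_1<\dots<p_k\}$ and $Q=\{q_1<\dots<q_k\}$ are adjacent if they interlace, i.e. if $p_1<q_1<p_2<q_2<\dots<p_k<q_k$ or $q_1<p_1<q_2<p_2<\dots<q_k<p_k$. For positive integers $m,d$ let $K_{m/d}$ be the circular clique: its vertex set is $\mathbb{Z}/m\mathbb{Z}$, and two vertices are adjacent if their distance around the cycle $\mathbb{Z}/m\mathbb{Z}$ is at least $d$. The circular clique number $\omega_c(G)$ of a graph $G$ is the maximal rational number $m/d$, with $m,d$ positive integers, for which there is a graph homomorphism $K_{m/d}\to G$. Then: 1. $\omega_c\bigl(\mathrm{IG}_{n,k}^{(r)}\bigr)=n/k$ (in particular, the maximum exists). 2. For $0\le j<n$ let $P^j=\{j+n,\ j+\lceil n/k\rceil,\ j+\lceil 2n/k\rceil,\dots,\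 j+\lceil (k-1)n/k\rceil\}$, where the points are taken modulo $n$ in $\{1,\dots,n\}$. Every $P^j$ is a vertex of $\mathrm{IG}_{n,k}^{(r)}$. If $n',k'$ are positive integers with $\gcd(n',k')=1$ and $n'/k'=n/k$, then the subgraph of $\mathrm{IG}_{n,k}^{(r)}$ induced by the set $\{P^j : 0\le j<n\}$ is isomorphic to $K_{n'/k'}$ (in particular, this set has exactly $n'$ elements). -/

import Mathlib

/-- The circular clique `K_{m/d}`: its vertices are the elements of `ℤ/mℤ`, and two of them are
adjacent when their distance around the cycle `ℤ/mℤ` is at least `d`. (For positive `m` and `d` the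
condition `a ≠ b` is automatic; it only makes the definition total.) -/
def circularClique (m d : ℕ) : SimpleGraph (ZMod m) where
  Adj a b := a ≠ b ∧ d ≤ (a - b).valMinAbs.natAbs
  symm := ⟨fun a b h => ⟨h.1.symm, by
    rw [← neg_sub, ZMod.natAbs_valMinAbs_neg]; exact h.2⟩⟩
  loopless := ⟨fun _ h => h.1 rfl⟩

/-- `q` is the circular clique number of `G`: the largest rational number of the form `m / d`, with
`m` and `d` positive integers, for which there is a graph homomorphism `K_{m/d} → G`. -/
def IsCircularCliqueNumber {V : Type*} (G : SimpleGraph V) (q : ℚ) : Prop :=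
  IsGreatest {x : ℚ | ∃ m d : ℕ, 0 < m ∧ 0 < d ∧ x = (m : ℚ) / (d : ℚ) ∧
    Nonempty (circularClique m d →g G)} q

/-- `S` is an `r`-stable `k`-polygon on the points `1, …, n` placed in this order around a circle:
a `k`-subset of `{1, …, n}` such that on both arcs between any two distinct points `a < b` of `S`
there are at least `r - 1` further points (that is, both arcs have length at least `r`). -/
def IsStablePolygon (n k r : ℕ) (S : Finset ℕ) : Prop :=
  S ⊆ Finset.Icc 1 n ∧ S.card = k ∧
    ∀ a ∈ S, ∀ b ∈ S, a < b → a + r ≤ b ∧ b + r ≤ a + n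

/-- `P = {p₁, …, p_k}` and `Q = {q₁, …, q_k}` with `p₁ < q₁ < p₂ < q₂ < ⋯ < p_k < q_k`. -/
def InterlacesBefore (k : ℕ) (P Q : Finset ℕ) : Prop :=
  ∃ p q : Fin k → ℕ, Finset.univ.image p = P ∧ Finset.univ.image q = Q ∧
    (∀ i, p i < q i) ∧ ∀ i j, i < j → q i < p j

/-- Two `k`-subsets interlace. -/
def Interlacing (k : ℕ) (P Q : Finset ℕ) : Prop :=
  InterlacesBefore k P Q ∨ InterlacesBefore k Q P

/-- The `r`-interlacing graph `IG_{n,k}^{(r)}` on the `r`-stable `k`-polygons. (For `k ≥ 1` a polygon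
never interlaces with itself, so `P ≠ Q` is automatic.) -/
def interlacingGraph (n k r : ℕ) : SimpleGraph {S : Finset ℕ // IsStablePolygon n k r S} where
  Adj P Q := P ≠ Q ∧ Interlacing k P.1 Q.1
  symm := ⟨fun _ _ h => ⟨h.1.symm, h.2.symm⟩⟩
  loopless := ⟨fun _ h => h.1 rfl⟩

/-- The representative in `{1, …, n}` of the integer `x` modulo `n` (for `n ≥ 1`). -/
def circlePoint (n x : ℕ) : ℕ := (x + n - 1) % n + 1

/-- The rotation by `j` of the equidistributed polygon
`{n, ⌈n/k⌉, ⌈2n/k⌉, …, ⌈(k-1)n/k⌉}`, with points taken modulo `n` in `{1, …, n}`. -/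
def equiPolygon (n k j : ℕ) : Finset ℕ :=
  (Finset.range k).image fun i : ℕ => circlePoint n (j + ⌈((i : ℚ) * (n : ℚ)) / (k : ℚ)⌉₊)

/-! Upper bound: interlacing polygons are disjoint, so under a homomorphism from `K_{m/d}` the
vertices whose polygons contain a given point are pairwise nonadjacent. If `2d ≤ m`, there are at
most `d` of them, and counting incidences gives `mk ≤ nd` (`mul_le_mul_of_circularClique_hom`).

Lower bound and structure: write `n = gN`, `k = gK` with `N`, `K` coprime. As `x` runs through `1,
…, n`, the multiple `Kx` winds `gK = k` times around `ℤ/Nℤ` in steps of `K`, so a half-open arc of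
length `K` is hit once per turn. The points that hit it form a `k`-polygon, and these polygons are
exactly the `P^j`, with the arc starting at `Kj` (`mem_equiPolygon_iff`). Disjoint arcs are hit
alternately, so their polygons interlace; overlapping arcs give a common point because `K` is
invertible mod `N`. Hence adjacency is that of `K_{N/K}` (`arcVertex_adj_iff`). -/

/-! ### Independent sets of circular cliques and the upper bound -/

/-- The distance around the cycle, in terms of the representatives in `[0, m)`. -/
theorem natAbs_valMinAbs_sub {m : ℕ} [NeZero m] {a b : ZMod m} (h : b.val ≤ a.val) :
    (a - b).valMinAbs.natAbs = min (a.val - b.val) (m - (a.val - b.val)) := by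
  rw [ZMod.valMinAbs_natAbs_eq_min, ZMod.val_sub h]

theorem circularClique_adj_iff_of_val_le {m d : ℕ} [NeZero m] (hd : 0 < d) {a b : ZMod m}
    (h : b.val ≤ a.val) :
    (circularClique m d).Adj a b ↔ b.val + d ≤ a.val ∧ a.val + d ≤ b.val + m := by
  have ha := ZMod.val_lt a
  have : (circularClique m d).Adj a b ↔ a ≠ b ∧ d ≤ (a - b).valMinAbs.natAbs := Iff.rfl
  rw [this, natAbs_valMinAbs_sub h]
  constructor
  · rintro ⟨-, h2⟩
    omega
  · rintro h2
    refine ⟨?_, by omega⟩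
    rintro rfl
    omega

/-- The independence number of `K_{m/d}` is at most `d` when `2 d ≤ m`. -/
theorem card_le_of_isIndepSet_circularClique {m d : ℕ} [NeZero m] (hd : 0 < d) (hm : 2 * d ≤ m)
    (T : Finset (ZMod m)) (hT : ∀ a ∈ T, ∀ b ∈ T, ¬ (circularClique m d).Adj a b) :
    T.card ≤ d := by
  rcases T.eq_empty_or_nonempty with rfl | ⟨a, ha⟩
  · simp
  have key : ∀ b ∈ T, ∀ c ∈ T, (c - a).val ≤ (b - a).val →
      ¬ ((c - a).val + d ≤ (b - a).val ∧ (b - a).val + d ≤ (c - a).val + m) := by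
    intro b hb c hc hle h
    rw [← circularClique_adj_iff_of_val_le hd hle] at h
    obtain ⟨h1, h2⟩ := h
    rw [sub_sub_sub_cancel_right] at h2
    exact hT b hb c hc ⟨fun h => h1 (by rw [h]), h2⟩
  have key0 : ∀ b ∈ T, (b - a).val < d ∨ m < (b - a).val + d := by
    intro b hb
    have := key b hb a ha
    rw [sub_self, ZMod.val_zero] at this
    have := this (Nat.zero_le _)
    omega
  -- Offsets from `a` lie in `[0, d)` or `(m - d, m)`; the second range is folded onto the first.
  -- Two offsets with the same image differ by `m - d`, which lies between `d` and `m - d`, so they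
  -- would be adjacent.
  have hinj := Finset.card_le_card_of_injOn (s := T) (t := Finset.range d)
    (fun b => if (b - a).val < d then (b - a).val else (b - a).val + d - m) ?_ ?_
  · simpa using hinj
  · intro b hb
    have := key0 b hb
    have := ZMod.val_lt (b - a)
    simp only [Finset.coe_range, Set.mem_Iio]
    split_ifs <;> omega
  · intro b hb c hc h
    have h1 := key0 b hb
    have h2 := key0 c hc
    have h3 := key b hb c hc
    have h4 := key c hc b hb
    have : (b - a).val = (c - a).val := by
      simp only at h
      split_ifs at h <;> omega
    exact sub_left_injective (ZMod.val_injective m this)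

theorem InterlacesBefore.disjoint {k : ℕ} {P Q : Finset ℕ} (h : InterlacesBefore k P Q) :
    Disjoint P Q := by
  obtain ⟨p, q, rfl, rfl, h1, h2⟩ := h
  rw [Finset.disjoint_left]
  intro x hx hy
  obtain ⟨i, -, rfl⟩ := Finset.mem_image.1 hx
  obtain ⟨j, -, hj⟩ := Finset.mem_image.1 hy
  rcases lt_trichotomy i j with hij | rfl | hij
  · have := h2 i j hij
    have := h1 i
    have := h1 j
    omega
  · have := h1 i
    omega
  · have := h2 j i hij
    omega

theorem Interlacing.disjoint {k : ℕ} {P Q : Finset ℕ} (h : Interlacing k P Q) : Disjoint P Q :=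
  h.elim InterlacesBefore.disjoint fun h => h.disjoint.symm

/-- The fibres `{a : x ∈ φ a}` of a homomorphism `φ` are independent sets of `K_{m/d}`. -/
theorem mul_le_mul_of_circularClique_hom {n k r m d : ℕ} (hm : 0 < m) (hd : 0 < d)
    (hmd : 2 * d ≤ m) (φ : circularClique m d →g interlacingGraph n k r) : m * k ≤ n * d := by
  have : NeZero m := ⟨hm.ne'⟩
  calc m * k = ∑ a : ZMod m, (φ a).1.card := by
        simp [fun a => (φ a).2.2.1, ZMod.card]
    _ = ∑ a : ZMod m, ∑ x ∈ Finset.Icc 1 n, if x ∈ (φ a).1 then 1 else 0 := by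
        refine Finset.sum_congr rfl fun a _ => ?_
        rw [Finset.sum_boole, Finset.filter_mem_eq_inter, Finset.inter_eq_right.2 (φ a).2.1,
          Nat.cast_id]
    _ = ∑ x ∈ Finset.Icc 1 n, ({a : ZMod m | x ∈ (φ a).1} : Finset (ZMod m)).card := by
        rw [Finset.sum_comm]
        simp only [Finset.sum_boole, Nat.cast_id]
    _ ≤ ∑ x ∈ Finset.Icc 1 n, d := by
        refine Finset.sum_le_sum fun x _ => card_le_of_isIndepSet_circularClique hd hmd _ ?_
        intro a ha b hb hab
        rw [Finset.mem_filter] at ha hb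
        exact Finset.disjoint_left.1 (φ.map_adj hab).2.disjoint ha.2 hb.2
    _ = n * d := by simp

/-! ### Arc polygons: membership, stability, interlacing -/

/-- The first natural number `x` with `i N + c ≤ K x`. -/
def arcPoint (N K c i : ℕ) : ℕ := (i * N + c + (K - 1)) / K

/-- The numbers `x` for which `K x` enters the arc `[c, c + K)` of `ℤ/Nℤ` during the first `k`
turns. -/
def arcPolygon (N K k c : ℕ) : Finset ℕ := (Finset.range k).image (arcPoint N K c)

theorem eq_arcPoint_iff {N K c i x : ℕ} (hK : 0 < K) :
    x = arcPoint N K c i ↔ i * N + c ≤ K * x ∧ K * x < i * N + c + K := by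
  rw [arcPoint, eq_comm, Nat.div_eq_iff hK, mul_comm x K]
  omega

theorem le_mul_arcPoint {N K c : ℕ} (hK : 0 < K) (i : ℕ) : i * N + c ≤ K * arcPoint N K c i :=
  ((eq_arcPoint_iff hK).1 rfl).1

theorem mul_arcPoint_lt {N K c : ℕ} (hK : 0 < K) (i : ℕ) : K * arcPoint N K c i < i * N + c + K :=
  ((eq_arcPoint_iff hK).1 rfl).2

/-- The integer multiple `K y` lies in the arc `[z, z + K)` modulo `N`. -/
def InArc (N K : ℕ) (z y : ℤ) : Prop := ∃ i : ℤ, i * N + z ≤ K * y ∧ K * y < i * N + z + K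

theorem inArc_congr {N K : ℕ} {z w y : ℤ} (h : z ≡ w [ZMOD N]) :
    InArc N K z y ↔ InArc N K w y := by
  obtain ⟨t, ht⟩ := h.dvd
  constructor <;> rintro ⟨i, h1, h2⟩
  · exact ⟨i - t, by linarith, by linarith⟩
  · exact ⟨i + t, by linarith, by linarith⟩

/-- With `0 < c ≤ N`, the range `1 ≤ x ≤ gN` forces the turn index into `[0, gK)`, so the polygon is
described by a condition mod `N` alone. -/
theorem mem_arcPolygon_iff {N K g c x : ℕ} (hK : 0 < K) (hN : 0 < N) (hc : 0 < c) (hcN : c ≤ N) :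
    x ∈ arcPolygon N K (g * K) c ↔ x ∈ Finset.Icc 1 (g * N) ∧ InArc N K c x := by
  rw [arcPolygon, Finset.mem_image]
  constructor
  · rintro ⟨i, hi, rfl⟩
    rw [Finset.mem_range] at hi
    have h1 := le_mul_arcPoint (N := N) (c := c) hK i
    have h2 := mul_arcPoint_lt (N := N) (c := c) hK i
    refine ⟨Finset.mem_Icc.2 ⟨?_, ?_⟩, i, mod_cast h1, mod_cast h2⟩
    · by_contra h
      have : arcPoint N K c i = 0 := by omega
      rw [this] at h1
      omega
    · have h3 : (i + 1) * N ≤ g * K * N := Nat.mul_le_mul_right _ hi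
      have h4 : K * arcPoint N K c i < K * (g * N + 1) := by nlinarith
      have := Nat.lt_of_mul_lt_mul_left h4
      omega
  · rintro ⟨hx, i, h1, h2⟩
    rw [Finset.mem_Icc] at hx
    have hx1 : (K : ℤ) * 1 ≤ K * x := by gcongr; exact_mod_cast hx.1
    have hx2 : (K : ℤ) * x ≤ K * (g * N) := by gcongr; exact_mod_cast hx.2
    have hi0 : 0 ≤ i := by
      by_contra! h
      have : (i + 1) * (N : ℤ) ≤ 0 := mul_nonpos_of_nonpos_of_nonneg (by omega) (by omega)
      have : (c : ℤ) ≤ N := mod_cast hcN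
      linarith
    lift i to ℕ using hi0
    refine ⟨i, ?_, ((eq_arcPoint_iff hK).2 ⟨mod_cast h1, mod_cast h2⟩).symm⟩
    rw [Finset.mem_range]
    have h3 : i * N < g * K * N := by
      have : (i : ℤ) * N < g * K * N := by
        have : (0 : ℤ) < c := mod_cast hc
        linarith
      exact_mod_cast this
    exact Nat.lt_of_mul_lt_mul_right h3

/-- Successive arcs start at least `rK` apart and a point overshoots its start by less than `K`, so
the points differ by more than `r - 1`. -/
theorem arcPoint_add_le {N K c r i j : ℕ} (hK : 0 < K) (hr : r * K ≤ N) (hij : i < j) :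
    arcPoint N K c i + r ≤ arcPoint N K c j := by
  have h1 := mul_arcPoint_lt (N := N) (c := c) hK i
  have h2 := le_mul_arcPoint (N := N) (c := c) hK j
  have h3 : (i + 1) * N ≤ j * N := Nat.mul_le_mul_right _ hij
  have h4 : K * (arcPoint N K c i + r) < K * (arcPoint N K c j + 1) := by nlinarith
  have := Nat.lt_of_mul_lt_mul_left h4
  omega

theorem arcPoint_add_mul {N K c g i : ℕ} (hK : 0 < K) :
    arcPoint N K c (i + g * K) = arcPoint N K c i + g * N := by
  have h1 := le_mul_arcPoint (N := N) (c := c) hK i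
  have h2 := mul_arcPoint_lt (N := N) (c := c) hK i
  symm
  rw [eq_arcPoint_iff hK]
  constructor <;> nlinarith

theorem arcPolygon_isStablePolygon {N K g c r : ℕ} (hK : 0 < K) (hN : 0 < N) (hc : 0 < c)
    (hcN : c ≤ N) (hr0 : 0 < r) (hr : r * K ≤ N) :
    IsStablePolygon (g * N) (g * K) r (arcPolygon N K (g * K) c) := by
  have hmono : StrictMono (arcPoint N K c) := fun i j hij => by
    have := arcPoint_add_le (c := c) hK hr hij
    omega
  refine ⟨fun x hx => ((mem_arcPolygon_iff hK hN hc hcN).1 hx).1, ?_, ?_⟩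
  · rw [arcPolygon, Finset.card_image_of_injective _ hmono.injective, Finset.card_range]
  · intro a ha b hb hab
    obtain ⟨i, hi, rfl⟩ := Finset.mem_image.1 ha
    obtain ⟨j, hj, rfl⟩ := Finset.mem_image.1 hb
    rw [Finset.mem_range] at hi hj
    refine ⟨arcPoint_add_le hK hr (hmono.lt_iff_lt.1 hab), ?_⟩
    -- The gap across `n` is an ordinary gap to the copy of point `i` that comes `gK` turns later.
    rw [← arcPoint_add_mul hK]
    exact arcPoint_add_le hK hr (by omega)

theorem image_univ_fin_eq_arcPolygon (N K k c : ℕ) :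
    (Finset.univ.image fun i : Fin k => arcPoint N K c i) = arcPolygon N K k c := by
  ext x
  simp only [arcPolygon, Finset.mem_image, Finset.mem_univ, true_and, Finset.mem_range]
  exact ⟨fun ⟨i, h⟩ => ⟨i, i.2, h⟩, fun ⟨i, hi, h⟩ => ⟨⟨i, hi⟩, h⟩⟩

theorem arcPolygon_interlacesBefore {N K k c e : ℕ} (hK : 0 < K) (h1 : c + K ≤ e)
    (h2 : e + K ≤ c + N) : InterlacesBefore k (arcPolygon N K k c) (arcPolygon N K k e) := by
  refine ⟨fun i => arcPoint N K c i, fun i => arcPoint N K e i, image_univ_fin_eq_arcPolygon ..,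
    image_univ_fin_eq_arcPolygon .., fun i => ?_, fun i j hij => ?_⟩
  · have h3 := mul_arcPoint_lt (N := N) (c := c) hK i
    have h4 := le_mul_arcPoint (N := N) (c := e) hK i
    exact Nat.lt_of_mul_lt_mul_left (a := K) (by dsimp only; omega)
  · have h3 := mul_arcPoint_lt (N := N) (c := e) hK i
    have h4 := le_mul_arcPoint (N := N) (c := c) hK j
    have h5 : ((i : ℕ) + 1) * N ≤ j * N := Nat.mul_le_mul_right _ hij
    rw [add_mul] at h5
    exact Nat.lt_of_mul_lt_mul_left (a := K) (by dsimp only; omega)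

/-! ### Coprimality: overlapping arcs and injectivity -/

theorem exists_mul_eq_mul_add {N K : ℕ} (hN : 0 < N) (h : Nat.Coprime N K) (z : ℤ) :
    ∃ x : ℕ, x < N ∧ ∃ i : ℤ, (K : ℤ) * x = i * N + z := by
  have : NeZero N := ⟨hN.ne'⟩
  let u := ZMod.unitOfCoprime K h.symm
  refine ⟨((u⁻¹ : (ZMod N)ˣ) * (z : ZMod N) : ZMod N).val, ZMod.val_lt _, ?_⟩
  have h1 : ((K * (((u⁻¹ : (ZMod N)ˣ) * (z : ZMod N) : ZMod N).val : ℤ) : ℤ) : ZMod N) = z := by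
    push_cast
    rw [ZMod.natCast_zmod_val, ← ZMod.coe_unitOfCoprime K h.symm, Units.mul_inv_cancel_left]
  obtain ⟨t, ht⟩ := ((ZMod.intCast_eq_intCast_iff _ _ _).1 h1).symm.dvd
  exact ⟨t, by linarith⟩

theorem exists_mem_Icc_mul_eq_mul_add {N K g : ℕ} (hN : 0 < N) (hg : 0 < g) (h : Nat.Coprime N K)
    (z : ℤ) : ∃ x ∈ Finset.Icc 1 (g * N), ∃ i : ℤ, (K : ℤ) * x = i * N + z := by
  -- Solving for `z - K` and adding `1` to `x` moves the range from `[0, N)` to `[1, N]`.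
  obtain ⟨x, hx, i, hi⟩ := exists_mul_eq_mul_add hN h (z - K)
  refine ⟨x + 1, Finset.mem_Icc.2 ⟨by omega, ?_⟩, i, by push_cast; linarith⟩
  have := Nat.le_mul_of_pos_left N hg
  omega

/-- If two arcs overlap, one contains the start of the other, and every residue mod `N` is a
multiple of `K`. -/
theorem arcPolygon_not_disjoint {N K g c e : ℕ} (hK : 0 < K) (hN : 0 < N) (hg : 0 < g)
    (h : Nat.Coprime N K) (hc : 0 < c) (hcN : c ≤ N) (he : 0 < e) (heN : e ≤ N) (hce : c ≤ e)
    (hlt : e < c + K ∨ c + N < e + K) :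
    ¬ Disjoint (arcPolygon N K (g * K) c) (arcPolygon N K (g * K) e) := by
  rw [Finset.not_disjoint_iff]
  simp only [mem_arcPolygon_iff hK hN hc hcN, mem_arcPolygon_iff hK hN he heN]
  rcases hlt with hlt | hlt
  · obtain ⟨x, hx, i, hi⟩ := exists_mem_Icc_mul_eq_mul_add hN hg h e
    exact ⟨x, ⟨hx, i, by omega, by omega⟩, hx, i, by omega, by omega⟩
  · obtain ⟨x, hx, i, hi⟩ := exists_mem_Icc_mul_eq_mul_add hN hg h c
    -- Here it is `c + N` that lies in `[e, e + K)`, so the turn is counted one lower for `e`.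
    exact ⟨x, ⟨hx, i, by omega, by omega⟩, hx, i - 1, by linarith, by
      rw [sub_mul]; omega⟩

/-- The start of a proper arc is recognised by being inside while its predecessor is outside; the
points `x`, `y` below realise the residues `c` and `c - 1`. -/
theorem arcPolygon_injOn {N K g c e : ℕ} (hK : 0 < K) (hKN : K < N) (hg : 0 < g)
    (h : Nat.Coprime N K) (hc : 0 < c) (hcN : c ≤ N) (he : 0 < e) (heN : e ≤ N)
    (heq : arcPolygon N K (g * K) c = arcPolygon N K (g * K) e) : c = e := by
  have hN : 0 < N := by omega
  have key : ∀ x ∈ Finset.Icc 1 (g * N), (InArc N K c x ↔ InArc N K e x) := by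
    intro x hx
    have := Finset.ext_iff.1 heq x
    rw [mem_arcPolygon_iff hK hN hc hcN, mem_arcPolygon_iff hK hN he heN] at this
    tauto
  obtain ⟨x, hx, i, hi⟩ := exists_mem_Icc_mul_eq_mul_add hN hg h c
  obtain ⟨y, hy, j, hj⟩ := exists_mem_Icc_mul_eq_mul_add hN hg h (c - 1)
  obtain ⟨l, h1, h2⟩ := (key x hx).1 ⟨i, by omega, by omega⟩
  have hy' : ¬ InArc N K e y := by
    rw [← key y hy]
    rintro ⟨s, h3, h4⟩
    have h5 : s * (N : ℤ) < j * N := by omega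
    have h6 : s < j := lt_of_mul_lt_mul_right h5 (by omega)
    have h7 : (s + 1) * (N : ℤ) ≤ j * N := by gcongr; omega
    rw [add_mul] at h7
    omega
  -- Were `Kx` in the arc of `e` but not at its start, `Ky`, one step earlier mod `N`, would lie in
  -- it too.
  have h8 : l * (N : ℤ) + e = i * N + c := by
    by_contra hne
    exact hy' ⟨l + j - i, by rw [sub_mul, add_mul]; omega, by rw [sub_mul, add_mul]; omega⟩
  have h9 : (i - l) * (N : ℤ) = e - c := by rw [sub_mul]; omega
  have h10 : i - l = 0 := by
    by_contra hne
    rcases lt_or_gt_of_ne hne with h | h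
    · have : (i - l) * (N : ℤ) ≤ (-1) * N := by gcongr; omega
      omega
    · have : 1 * (N : ℤ) ≤ (i - l) * N := by gcongr; omega
      omega
  rw [h10] at h9
  omega

/-! ### Rotations of the equidistributed polygon as arc polygons -/

theorem circlePoint_mem_Icc {n : ℕ} (hn : 0 < n) (x : ℕ) : circlePoint n x ∈ Finset.Icc 1 n := by
  have := Nat.mod_lt (x + n - 1) hn
  rw [Finset.mem_Icc, circlePoint]
  omega

theorem exists_circlePoint_eq_add_mul {n : ℕ} (hn : 0 < n) (x : ℕ) :
    ∃ l : ℤ, (circlePoint n x : ℤ) = x + l * n := by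
  refine ⟨1 - ((x + n - 1) / n : ℕ), ?_⟩
  have h := Nat.div_add_mod (x + n - 1) n
  have h1 : (n : ℤ) * ((x + n - 1) / n : ℕ) + ((x + n - 1) % n : ℕ) + 1 = x + n := by
    have : n * ((x + n - 1) / n) + (x + n - 1) % n + 1 = x + n := by omega
    exact_mod_cast this
  rw [circlePoint]
  push_cast at h1 ⊢
  linarith

theorem eq_circlePoint {n x y : ℕ} (hx : x ∈ Finset.Icc 1 n) {l : ℤ} (h : (x : ℤ) = y + l * n) :
    x = circlePoint n y := by
  rw [Finset.mem_Icc] at hx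
  have hn : 0 < n := by omega
  obtain ⟨s, hs⟩ := exists_circlePoint_eq_add_mul hn y
  have hc := Finset.mem_Icc.1 (circlePoint_mem_Icc hn y)
  have h1 : (x : ℤ) - circlePoint n y = 0 := by
    refine Int.eq_zero_of_abs_lt_dvd (m := n) ⟨l - s, by linarith⟩ ?_
    rw [abs_lt]
    omega
  omega

theorem ceil_mul_div_bounds {N K g : ℕ} (hK : 0 < K) (hg : 0 < g) (i : ℕ) :
    i * N ≤ K * ⌈((i : ℚ) * ((g * N : ℕ) : ℚ)) / ((g * K : ℕ) : ℚ)⌉₊ ∧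
      K * ⌈((i : ℚ) * ((g * N : ℕ) : ℚ)) / ((g * K : ℕ) : ℚ)⌉₊ < i * N + K := by
  have hK' : (0 : ℚ) < K := mod_cast hK
  have hg' : (0 : ℚ) < g := mod_cast hg
  have h0 : ((i : ℚ) * ((g * N : ℕ) : ℚ)) / ((g * K : ℕ) : ℚ) = i * N / K := by
    push_cast
    field_simp
  rw [h0]
  have h1 := Nat.le_ceil ((i : ℚ) * N / K)
  have h2 := Nat.ceil_lt_add_one (a := (i : ℚ) * N / K) (by positivity)
  generalize ⌈(i : ℚ) * N / K⌉₊ = u at h1 h2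
  rw [div_le_iff₀ hK'] at h1
  rw [← sub_lt_iff_lt_add, lt_div_iff₀ hK'] at h2
  constructor
  · have : (i : ℚ) * N ≤ K * u := by linarith
    exact_mod_cast this
  · have : (K : ℚ) * u < i * N + K := by linarith
    exact_mod_cast this

theorem mem_equiPolygon_iff {N K g j x : ℕ} (hK : 0 < K) (hN : 0 < N) (hg : 0 < g) :
    x ∈ equiPolygon (g * N) (g * K) j ↔ x ∈ Finset.Icc 1 (g * N) ∧ InArc N K (K * j) x := by
  have hn : 0 < g * N := Nat.mul_pos hg hN
  rw [equiPolygon, Finset.mem_image]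
  constructor
  · rintro ⟨i, -, rfl⟩
    refine ⟨circlePoint_mem_Icc hn _, ?_⟩
    obtain ⟨h1, h2⟩ := ceil_mul_div_bounds (N := N) hK hg i
    obtain ⟨l, hl⟩ := exists_circlePoint_eq_add_mul hn
      (j + ⌈((i : ℚ) * ((g * N : ℕ) : ℚ)) / ((g * K : ℕ) : ℚ)⌉₊)
    -- Shifting a point by `l` circuits of length `gN` shifts its multiple by `l * g * K` turns.
    refine ⟨i + l * g * K, ?_, ?_⟩
    · zify at h1
      rw [hl]
      push_cast at h1 ⊢
      linarith
    · zify at h2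
      rw [hl]
      push_cast at h2 ⊢
      linarith
  · rintro ⟨hx, i, h1, h2⟩
    -- The turn index is reduced mod `gK`; the quotient counts full circuits, which `circlePoint`
    -- discards.
    have hk : (0 : ℤ) < (g * K : ℕ) := mod_cast Nat.mul_pos hg hK
    have hi0 := Int.emod_nonneg i hk.ne'
    have hik := Int.emod_lt_of_pos i hk
    have hid := Int.emod_add_mul_ediv i (g * K : ℕ)
    generalize i / ((g * K : ℕ) : ℤ) = l at hid
    generalize i % ((g * K : ℕ) : ℤ) = s at hid hi0 hik
    lift s to ℕ using hi0
    refine ⟨s, Finset.mem_range.2 (mod_cast hik), (eq_circlePoint (l := l) hx ?_).symm⟩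
    obtain ⟨h3, h4⟩ := ceil_mul_div_bounds (N := N) hK hg s
    generalize ⌈((s : ℚ) * ((g * N : ℕ) : ℚ)) / ((g * K : ℕ) : ℚ)⌉₊ = u at h3 h4
    zify at h3 h4
    subst hid
    push_cast at *
    have hK' : (0 : ℤ) < K := mod_cast hK
    have h5 : (K : ℤ) * (x - j - l * (g * N)) < K * (u + 1) := by linarith
    have h6 : (K : ℤ) * u < K * (x - j - l * (g * N) + 1) := by linarith
    have h7 := lt_of_mul_lt_mul_left h5 hK'.le
    have h8 := lt_of_mul_lt_mul_left h6 hK'.le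
    linarith [le_antisymm (Int.lt_add_one_iff.1 h7) (Int.lt_add_one_iff.1 h8)]

theorem equiPolygon_eq_arcPolygon {N K g j c : ℕ} (hK : 0 < K) (hN : 0 < N) (hg : 0 < g)
    (hc : 0 < c) (hcN : c ≤ N) (h : (K * j : ℤ) ≡ c [ZMOD N]) :
    equiPolygon (g * N) (g * K) j = arcPolygon N K (g * K) c := by
  ext x
  rw [mem_equiPolygon_iff hK hN hg, mem_arcPolygon_iff hK hN hc hcN, inArc_congr h]

/-- Every rotation of the equidistributed polygon is an arc polygon. -/
theorem exists_equiPolygon_eq_arcPolygon {N K g : ℕ} (hK : 0 < K) (hN : 0 < N) (hg : 0 < g)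
    (j : ℕ) : ∃ c < N, equiPolygon (g * N) (g * K) j = arcPolygon N K (g * K) (c + 1) := by
  have hN' : (0 : ℤ) < N := mod_cast hN
  -- Reducing `Kj - 1` rather than `Kj` puts the arc start `c + 1` in `[1, N]`.
  have h0 := Int.emod_nonneg (K * j - 1 : ℤ) hN'.ne'
  have h1 := Int.emod_lt_of_pos (K * j - 1 : ℤ) hN'
  have h2 : (K * j : ℤ) ≡ (K * j - 1) % N + 1 [ZMOD N] := by
    have := ((Int.mod_modEq (K * j - 1 : ℤ) N).add_right 1).symm
    rwa [sub_add_cancel] at this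
  generalize (K * j - 1 : ℤ) % N = c at h0 h1 h2
  lift c to ℕ using h0
  have hc : c < N := mod_cast h1
  exact ⟨c, hc, equiPolygon_eq_arcPolygon hK hN hg c.succ_pos hc (mod_cast h2)⟩

/-- Every arc polygon is a rotation of the equidistributed polygon. -/
theorem exists_arcPolygon_eq_equiPolygon {N K g c : ℕ} (hK : 0 < K) (hN : 0 < N) (hg : 0 < g)
    (h : Nat.Coprime N K) (hc : 0 < c) (hcN : c ≤ N) :
    ∃ j < g * N, arcPolygon N K (g * K) c = equiPolygon (g * N) (g * K) j := by
  obtain ⟨j, hj, i, hi⟩ := exists_mul_eq_mul_add hN h c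
  refine ⟨j, hj.trans_le (Nat.le_mul_of_pos_left N hg), ?_⟩
  refine (equiPolygon_eq_arcPolygon hK hN hg hc hcN ?_).symm
  exact (Int.modEq_iff_dvd.2 ⟨i, by linarith⟩).symm

/-! ### The isomorphism with the circular clique -/

/-- The arc polygon of `[c + 1, c + 1 + K)`, as a vertex of the interlacing graph. -/
def arcVertex {N K r : ℕ} (g : ℕ) [NeZero N] (hK : 0 < K) (hr0 : 0 < r) (hr : r * K ≤ N)
    (c : ZMod N) : {S : Finset ℕ // IsStablePolygon (g * N) (g * K) r S} :=
  ⟨arcPolygon N K (g * K) (c.val + 1),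
    arcPolygon_isStablePolygon hK (NeZero.pos N) c.val.succ_pos (ZMod.val_lt c) hr0 hr⟩

theorem arcVertex_injective {N K g r : ℕ} [NeZero N] (hK : 0 < K) (hr2 : 2 ≤ r) (hr : r * K ≤ N)
    (hg : 0 < g) (h : Nat.Coprime N K) :
    Function.Injective (arcVertex (K := K) g hK (two_pos.trans_le hr2) hr) := by
  intro a b hab
  have hKN : K < N := by nlinarith
  have := arcPolygon_injOn hK hKN hg h a.val.succ_pos (ZMod.val_lt a) b.val.succ_pos
    (ZMod.val_lt b) (congrArg Subtype.val hab)
  exact ZMod.val_injective N (by omega)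

theorem arcVertex_adj_iff {N K g r : ℕ} [NeZero N] (hK : 0 < K) (hr2 : 2 ≤ r) (hr : r * K ≤ N)
    (hg : 0 < g) (h : Nat.Coprime N K) (a b : ZMod N) :
    (interlacingGraph (g * N) (g * K) r).Adj
      (arcVertex g hK (two_pos.trans_le hr2) hr a) (arcVertex g hK (two_pos.trans_le hr2) hr b) ↔
      (circularClique N K).Adj a b := by
  wlog hba : b.val ≤ a.val generalizing a b
  · rw [SimpleGraph.adj_comm, this b a (by omega), SimpleGraph.adj_comm]
  have hb := ZMod.val_lt b
  have ha := ZMod.val_lt a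
  constructor
  · rintro ⟨-, h2⟩
    rw [circularClique_adj_iff_of_val_le hK hba]
    by_contra hne
    exact arcPolygon_not_disjoint hK (NeZero.pos N) hg h b.val.succ_pos hb a.val.succ_pos ha
      (by omega) (by omega) h2.disjoint.symm
  · intro hadj
    refine ⟨(arcVertex_injective hK hr2 hr hg h).ne hadj.1, Or.inr ?_⟩
    rw [circularClique_adj_iff_of_val_le hK hba] at hadj
    exact arcPolygon_interlacesBefore hK (by omega) (by omega)

theorem nonempty_circularClique_iso {N K g r : ℕ} (hN : 0 < N) (hK : 0 < K) (hr2 : 2 ≤ r)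
    (hr : r * K ≤ N) (hg : 0 < g) (h : Nat.Coprime N K) :
    Nonempty (circularClique N K ≃g (interlacingGraph (g * N) (g * K) r).induce
      {P | ∃ j : ℕ, j < g * N ∧ P.1 = equiPolygon (g * N) (g * K) j}) := by
  have : NeZero N := ⟨hN.ne'⟩
  let f : ZMod N → {P : {S : Finset ℕ // IsStablePolygon (g * N) (g * K) r S} |
      ∃ j : ℕ, j < g * N ∧ P.1 = equiPolygon (g * N) (g * K) j} := fun c =>
    ⟨arcVertex g hK (two_pos.trans_le hr2) hr c,
      exists_arcPolygon_eq_equiPolygon hK hN hg h c.val.succ_pos (ZMod.val_lt c)⟩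
  have hf : Function.Bijective f := by
    refine ⟨fun a b hab => arcVertex_injective hK hr2 hr hg h (congrArg Subtype.val hab), ?_⟩
    rintro ⟨⟨P, hP⟩, j, hj, hPj⟩
    obtain ⟨c, hc, hcP⟩ := exists_equiPolygon_eq_arcPolygon hK hN hg j
    refine ⟨(c : ZMod N), Subtype.ext (Subtype.ext ?_)⟩
    change arcPolygon N K (g * K) ((c : ZMod N).val + 1) = P
    rw [ZMod.val_natCast_of_lt hc, ← hcP]
    exact hPj.symm
  exact ⟨⟨Equiv.ofBijective f hf, arcVertex_adj_iff hK hr2 hr hg h _ _⟩⟩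

/-! ### Reduction to lowest terms and conclusion -/

theorem exists_eq_mul_of_div_eq_div {n k N K : ℕ} (hk : 0 < k) (hK : 0 < K)
    (hcop : Nat.Coprime N K) (h : (N : ℚ) / K = n / k) : ∃ g, n = g * N ∧ k = g * K := by
  rw [div_eq_div_iff (by positivity) (by positivity)] at h
  have h1 : N * k = n * K := mod_cast h
  obtain ⟨g, rfl⟩ := hcop.symm.dvd_of_dvd_mul_left (Dvd.intro_left n h1.symm)
  refine ⟨g, Nat.eq_of_mul_eq_mul_right hK ?_, mul_comm _ _⟩
  rw [← h1]
  ring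

theorem theorem4 (n k r : ℕ) (hk : 1 ≤ k) (hr : 2 ≤ r) (hn : r * k ≤ n) :
    IsCircularCliqueNumber (interlacingGraph n k r) ((n : ℚ) / (k : ℚ)) ∧
    (∀ j : ℕ, j < n → IsStablePolygon n k r (equiPolygon n k j)) ∧
    ∀ n' k' : ℕ, 0 < k' → Nat.Coprime n' k' → (n' : ℚ) / (k' : ℚ) = (n : ℚ) / (k : ℚ) →
      Nonempty (circularClique n' k' ≃g
        (interlacingGraph n k r).induce {P | ∃ j : ℕ, j < n ∧ P.1 = equiPolygon n k j}) := by
  have hdata : ∀ n' k' : ℕ, 0 < k' → Nat.Coprime n' k' → (n' : ℚ) / k' = (n : ℚ) / k →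
      ∃ g, n = g * n' ∧ k = g * k' ∧ 0 < g ∧ 0 < n' ∧ r * k' ≤ n' := by
    intro n' k' hk' hcop h
    obtain ⟨g, rfl, rfl⟩ := exists_eq_mul_of_div_eq_div hk hk' hcop h
    have hg : 0 < g := Nat.pos_of_mul_pos_right hk
    have hrk : r * k' ≤ n' := Nat.le_of_mul_le_mul_left (by linarith) hg
    exact ⟨g, rfl, rfl, hg, by nlinarith, hrk⟩
  have hiso : ∀ n' k' : ℕ, 0 < k' → Nat.Coprime n' k' → (n' : ℚ) / (k' : ℚ) = (n : ℚ) / (k : ℚ) →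
      Nonempty (circularClique n' k' ≃g
        (interlacingGraph n k r).induce {P | ∃ j : ℕ, j < n ∧ P.1 = equiPolygon n k j}) := by
    intro n' k' hk' hcop h
    obtain ⟨g, rfl, rfl, hg, hn', hrk⟩ := hdata n' k' hk' hcop h
    exact nonempty_circularClique_iso hn' hk' hr hrk hg hcop
  have hgcd : 0 < n.gcd k := Nat.gcd_pos_of_pos_right n hk
  have hK : 0 < k / n.gcd k := Nat.div_pos (Nat.gcd_le_right n hk) hgcd
  have hcop : Nat.Coprime (n / n.gcd k) (k / n.gcd k) := Nat.coprime_div_gcd_div_gcd hgcd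
  have hred : ((n / n.gcd k : ℕ) : ℚ) / (k / n.gcd k : ℕ) = (n : ℚ) / k := by
    rw [Nat.cast_div (Nat.gcd_dvd_left n k) (by positivity),
      Nat.cast_div (Nat.gcd_dvd_right n k) (by positivity),
      div_div_div_cancel_right₀ (by positivity)]
  generalize n / n.gcd k = N at hcop hred
  generalize k / n.gcd k = K at hcop hred hK
  refine ⟨⟨?_, ?_⟩, ?_, hiso⟩
  · obtain ⟨g, -, -, -, hN, -⟩ := hdata N K hK hcop hred
    obtain ⟨φ⟩ := hiso N K hK hcop hred
    exact ⟨N, K, hN, hK, hred.symm,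
      ⟨(SimpleGraph.Embedding.induce _).toHom.comp φ.toHom⟩⟩
  · rintro x ⟨m, d, hm, hd, rfl, ⟨φ⟩⟩
    rw [div_le_div_iff₀ (by positivity) (by positivity)]
    norm_cast
    rcases le_or_gt (2 * d) m with hmd | hmd
    · exact mul_le_mul_of_circularClique_hom hm hd hmd φ
    -- For `m < 2d` the homomorphism is not needed: `m/d < 2 ≤ r ≤ n/k`.
    · nlinarith [Nat.mul_le_mul_right k hr]
  · intro j _
    obtain ⟨g, rfl, rfl, hg, hN, hrK⟩ := hdata N K hK hcop hred
    obtain ⟨c, hc, h⟩ := exists_equiPolygon_eq_arcPolygon hK hN hg j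
    rw [h]
    exact arcPolygon_isStablePolygon hK hN c.succ_pos hc (by omega) hrK
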